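/- All monoids are commutative, and $\mathbb N_0=\{0,1,2,\dots\}$. An atom of a cancellative monoid $M$ is a non-unit $a$ such that $a=bc$ implies that $b$ or $c$ is a unit. A factorization of $h\in M$ of length $\ell\in\mathbb N_0$ is an expression $h=u_1\cdots u_\ell$ with atoms $u_i$; two factorizations are essentially the same if they agree up to the order of the factors and up to associates. For $\ell\in\mathbb N_0$, let $\#_{L(h)}(\ell)$ be the cardinality of the set of factorizations of $h$ of length $\ell$, modulo being essentially the same. This defines the multiset of lengths $L(h)$ of $h$. A multiset $L$ of integers $\ge 2$ is given by arbitrary cardinal numbers $\#_L(\ell)$, $\ell\in\mathbb N_0$, with $\#_L(0)=\#_L(1)=0$; it is finite if all $\#_L(\ell)$ are finite and only finitely many of them are nonzero. A monoid is torsion-free if $a^n=b^n$ with $n\ge 1$ implies $a=b$. Consider the following conditions on a non-principal ultrafilter $\mathcal U$ on $\omega=\{0,1,2,\dots\}$ and a family $(H_\lambda)_{\lambda\in\omega}$ of cancellative monoids with ultraproduct $H^*=\prod^{\mathcal U}_{\lambda\in\omega}H_\lambda$: (F) for every $\lambda\in\omega$ and every nonempty finite multiset $L$ of integers $\ge 2$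 there is $h\in H_\lambda$ with $\#_{L(h)}(\ell)=\#_L(\ell)$ for all $\ell\in\mathbb N_0$; (T) $H^*$ is torsion-free. Then: 1. For every non-principal ultrafilter $\mathcal U$ on $\omega$ there is a family $(H_\lambda)_{\lambda\in\omega}$ of cancellative monoids such that (F) and (T) hold. 2. Whenever (F) and (T) hold and $K$ is a field, the semigroup ring $K[H^*]$ is an integral domain, and for every multiset $L$ of integers $\ge 2$ there is a nonzero $f\in K[H^*]$ such that, with factorizations taken in the multiplicative monoid $K[H^*]\setminus\{0\}$, for all $\ell\in\mathbb N_0$: $\#_{L(f)}(\ell)=\#_L(\ell)$ if $\#_L(\ell)$ is finite, and $\#_{L(f)}(\ell)$ is infinite if and only if $\#_L(\ell)$ is infinite. -/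

import Mathlib

universe u v w

/-- The factorizations `h = u 0 * ⋯ * u (ℓ - 1)` of `h` into `ℓ` atoms. The notion `Irreducible` is
stated for monoids: a non-unit `a` such that `a = b * c` forces `b` or `c` to be a unit. -/
def Factorization {M : Type u} [CommMonoid M] (h : M) (ℓ : ℕ) : Type u :=
  {a : Fin ℓ → M // (∀ i, Irreducible (a i)) ∧ ∏ i, a i = h}

/-- Two factorizations are essentially the same if they agree up to the order of the factors and
up to associates. -/
def essentiallySame {M : Type u} [CommMonoid M] (h : M) (ℓ : ℕ) : Setoid (Factorization h ℓ) where
  r a b := ∃ σ : Equiv.Perm (Fin ℓ), ∀ i, Associated (a.1 i) (b.1 (σ i))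
  iseqv :=
    { refl := fun a => ⟨1, fun i => Associated.refl _⟩
      symm := by
        rintro a b ⟨σ, h⟩
        refine ⟨σ⁻¹, fun i => ?_⟩
        have := (h (σ⁻¹ i)).symm
        simpa using this
      trans := by
        rintro a b c ⟨σ, h⟩ ⟨τ, k⟩
        exact ⟨τ * σ, fun i => (h i).trans (k (σ i))⟩ }

/-- The multiplicity of `ℓ` in the multiset of lengths of `h`: the cardinal number of the set of
factorizations of `h` of length `ℓ`, up to being essentially the same. -/
noncomputable def lengthMultiplicity {M : Type u} [CommMonoid M] (h : M) (ℓ : ℕ) : Cardinal.{u} :=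
  Cardinal.mk (Quotient (essentiallySame h ℓ))

/-- Every nonempty finite multiset of integers `≥ 2` is the multiset of lengths of some element. -/
def RealizesFiniteMultisets (M : Type u) [CommMonoid M] : Prop :=
  ∀ L : Multiset ℕ, L ≠ 0 → (∀ m ∈ L, 2 ≤ m) →
    ∃ h : M, ∀ ℓ : ℕ, lengthMultiplicity h ℓ = (L.count ℓ : Cardinal.{u})

/-- The congruence on the product of a family of monoids that identifies two families if they
agree on a member of the ultrafilter `U`. -/
def ultraCon {Λ : Type v} (U : Ultrafilter Λ) (H : Λ → Type u) [∀ i, CommMonoid (H i)] :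
    Con (∀ i, H i) where
  r a b := {i | a i = b i} ∈ U
  iseqv :=
    { refl := fun a => Filter.Eventually.of_forall (f := (U : Filter Λ)) fun _ => rfl
      symm := fun {a b} h => by simpa [eq_comm] using h
      trans := fun {a b c} h k => by
        filter_upwards [h, k] with i hi ki using Eq.trans hi ki }
  mul' := fun {a b c d} h k => by
    filter_upwards [h, k] with i hi ki
    exact congrArg₂ (· * ·) hi ki

/-- The ultraproduct of a family of monoids, with componentwise multiplication of
representatives. -/
abbrev Ultraproduct {Λ : Type v} (U : Ultrafilter Λ) (H : Λ → Type u) [∀ i, CommMonoid (H i)] :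
    Type (max u v) :=
  (ultraCon U H).Quotient

/-- Every multiset of integers `≥ 2` (its multiplicities `L ℓ` being arbitrary cardinal numbers) is
the multiset of lengths of some element, infinite multiplicities not being distinguished. -/
def RealizesAllMultisets (M : Type u) [CommMonoid M] : Prop :=
  ∀ L : ℕ → Cardinal.{v}, (∀ ℓ, ℓ < 2 → L ℓ = 0) →
    ∃ h : M, ∀ ℓ : ℕ,
      (L ℓ < Cardinal.aleph0 →
        Cardinal.lift.{v} (lengthMultiplicity h ℓ) = Cardinal.lift.{u} (L ℓ)) ∧
      (Cardinal.aleph0 ≤ lengthMultiplicity h ℓ ↔ Cardinal.aleph0 ≤ L ℓ)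

/-! For fixed natural numbers `n` and `ℓ`, having at least `n` essentially different factorizations
of length `ℓ` is a first-order property. Hence, as in Łoś's theorem, it holds for a class in the
ultraproduct iff it holds at `U`-almost every index
(`natCast_le_lengthMultiplicity_ultraCon_mk_iff`). Given `L`, realize in `H i` a finite truncation
of `L` that grows with `i`. The class of these elements has at least `n` factorizations of length
`ℓ` exactly when `n ≤ L ℓ`, so finite multiplicities are exact and infinite ones are infinite.

A cancellative torsion-free monoid has two unique products. So its semigroup ring over a field is a
domain in which every factor of a monomial is a monomial (`exists_eq_single_of_mul_eq_single`), and
passing from an element to its monomial preserves factorizations.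

For existence, take a constant family. Its member is generated by disjoint blocks, one for each copy
of each length in each finite multiset, subject only to the relations that blocks of the same
multiset have equal products. It lies in a torsion-free group, and the only factorizations of a
block product are the blocks of that multiset (`blockValue_eq_block_iff`). -/

open Filter Cardinal

/-! ### Counting factorizations -/

theorem exists_perm_of_map_univ_eq {n : ℕ} {α : Type u} {f g : Fin n → α}
    (h : Finset.univ.val.map f = Finset.univ.val.map g) :
    ∃ σ : Equiv.Perm (Fin n), ∀ i, f i = g (σ i) := by
  classical
  have e : ∀ a, Nonempty ({i // f i = a} ≃ {i // g i = a}) := fun a => by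
    rw [← Fintype.card_eq, Fintype.card_subtype, Fintype.card_subtype]
    have := congrArg (Multiset.count a) h
    simp only [Multiset.count_map] at this
    simpa only [eq_comm, Finset.card_def, Finset.filter_val] using this
  refine ⟨(Equiv.sigmaFiberEquiv f).symm.trans ((Equiv.sigmaCongrRight fun a =>
    Classical.choice (e a)).trans (Equiv.sigmaFiberEquiv g)), fun i => ?_⟩
  exact (Classical.choice (e (f i)) ⟨i, rfl⟩).2.symm

theorem Multiset.exists_map_univ_eq {α : Type u} (c : Multiset α) :
    ∃ f : Fin c.card → α, Finset.univ.val.map f = c :=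
  Quotient.inductionOn c fun l =>
    ⟨l.get, (Fin.univ_val_map _).trans (congrArg _ (List.ofFn_get l))⟩

/-- In a monoid generated by elements `x a` that have no other factorization than the trivial one,
the multiplicity of a length counts the multisets of generators with the given product. -/
theorem lengthMultiplicity_of_generators {M A : Type u} [CommMonoid M] (x : A → M)
    (hgen : ∀ m, ∃ c : Multiset A, (c.map x).prod = m)
    (hone : ∀ c : Multiset A, (c.map x).prod = 1 → c = 0)
    (hatom : ∀ (c : Multiset A) a, (c.map x).prod = x a → c = {a}) (h : M) (ℓ : ℕ) :
    lengthMultiplicity h ℓ =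
      Cardinal.mk {c : Multiset A // c.card = ℓ ∧ (c.map x).prod = h} := by
  have hx : Function.Injective x := fun a b hab => by
    simpa using hatom {a} b (by simpa using hab)
  have hunit : ∀ m : M, IsUnit m → m = 1 := by
    intro m hm
    obtain ⟨n, hn⟩ := hm.exists_right_inv
    obtain ⟨c, rfl⟩ := hgen m
    obtain ⟨d, rfl⟩ := hgen n
    have := hone (c + d) (by simpa using hn)
    simp [(add_eq_zero.1 this).1]
  have hassoc : ∀ a b : M, Associated a b → a = b := by
    rintro a b ⟨w, rfl⟩
    rw [hunit w w.isUnit, mul_one]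
  have hirr : ∀ a, Irreducible (x a) := by
    intro a
    refine ⟨fun hu => ?_, fun b d hbd => ?_⟩
    · simpa using hatom 0 a (by simpa using (hunit _ hu).symm)
    · obtain ⟨b, rfl⟩ := hgen b
      obtain ⟨d, rfl⟩ := hgen d
      have := hatom (b + d) a (by simpa using hbd.symm)
      have hc := congrArg Multiset.card this
      rw [Multiset.card_add, Multiset.card_singleton] at hc
      rcases Nat.add_eq_one_iff.1 hc with hc | hc
      · left; rw [Multiset.card_eq_zero.1 hc.1]; simp
      · right; rw [Multiset.card_eq_zero.1 hc.2]; simp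
  have hex : ∀ m, Irreducible m → ∃ a, m = x a := by
    intro m hm
    obtain ⟨c, rfl⟩ := hgen m
    induction c using Multiset.induction_on with
    | empty => simp at hm
    | cons a c _ =>
      rw [Multiset.map_cons, Multiset.prod_cons] at hm ⊢
      rcases hm.isUnit_or_isUnit rfl with hu | hu
      · exact absurd hu (hirr a).not_isUnit
      · exact ⟨a, by rw [hunit _ hu, mul_one]⟩
  choose g hg using fun (α : Factorization h ℓ) i => hex _ (α.2.1 i)
  have hprod : ∀ f : Fin ℓ → A, ((Finset.univ.val.map f).map x).prod = ∏ i, x (f i) := by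
    intro f; rw [Multiset.map_map]; rfl
  let F : Factorization h ℓ → {c : Multiset A // c.card = ℓ ∧ (c.map x).prod = h} := fun α =>
    ⟨Finset.univ.val.map (g α), by simp, by
      rw [hprod, ← α.2.2]; exact Finset.prod_congr rfl fun i _ => (hg α i).symm⟩
  have hF : ∀ α β, F α = F β ↔ (essentiallySame h ℓ).r α β := by
    intro α β
    constructor
    · intro hab
      obtain ⟨σ, hσ⟩ := exists_perm_of_map_univ_eq (congrArg Subtype.val hab)
      exact ⟨σ, fun i => by rw [hg α, hg β, hσ]⟩
    · rintro ⟨σ, hσ⟩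
      apply Subtype.ext
      have : g α = g β ∘ σ := funext fun i => hx <| by
        rw [← hg α, Function.comp, ← hg β]; exact hassoc _ _ (hσ i)
      change Finset.univ.val.map (g α) = Finset.univ.val.map (g β)
      rw [this, ← Multiset.map_map, Multiset.map_univ_val_equiv]
  have hsurj : Function.Surjective F := by
    rintro ⟨c, hl, hc⟩
    obtain ⟨f, rfl⟩ : ∃ f : Fin ℓ → A, Finset.univ.val.map f = c :=
      hl ▸ c.exists_map_univ_eq
    refine ⟨⟨fun i => x (f i), fun i => hirr _, by rw [← hc, hprod]⟩, Subtype.ext ?_⟩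
    change Finset.univ.val.map (g _) = Finset.univ.val.map f
    exact Multiset.map_congr rfl fun i _ => hx (hg ⟨fun i => x (f i), _⟩ i).symm
  refine Cardinal.mk_congr (Equiv.ofBijective (Quotient.lift F fun α β => (hF α β).2) ⟨?_, ?_⟩)
  · rintro ⟨α⟩ ⟨β⟩ hab
    exact Quotient.sound ((hF α β).1 hab)
  · intro c
    obtain ⟨α, rfl⟩ := hsurj c
    exact ⟨⟦α⟧, rfl⟩

/-- Removes the quotient and the cardinal: what remains quantifies over finitely many elements of
`M`, the form that transfers to ultraproducts. -/
theorem natCast_le_lengthMultiplicity_iff {M : Type u} [CommMonoid M] {h : M} {ℓ n : ℕ} :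
    (n : Cardinal) ≤ lengthMultiplicity h ℓ ↔
      ∃ f : Fin n → Fin ℓ → M, (∀ k i, Irreducible (f k i)) ∧ (∀ k, ∏ i, f k i = h) ∧
        ∀ k k', k ≠ k' → ∀ σ : Equiv.Perm (Fin ℓ), ∃ i, ¬ Associated (f k i) (f k' (σ i)) := by
  have : (n : Cardinal.{u}) = Cardinal.lift.{u} (Cardinal.mk (Fin n)) := by simp
  rw [lengthMultiplicity, this, ← Cardinal.lift_uzero (Cardinal.mk (Quotient _)),
    Cardinal.lift_mk_le']
  constructor
  · rintro ⟨e⟩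
    refine ⟨fun k => (e k).out.1, fun k => (e k).out.2.1, fun k => (e k).out.2.2,
      fun k k' hk σ => ?_⟩
    by_contra! hσ
    exact hk (e.injective (Quotient.out_equiv_out.1 ⟨σ, hσ⟩))
  · rintro ⟨f, hf, hf', hne⟩
    refine ⟨fun k => Quotient.mk _ ⟨f k, hf k, hf' k⟩, fun k k' hk => ?_⟩
    by_contra hkk
    obtain ⟨σ, hσ⟩ := Quotient.exact hk
    obtain ⟨i, hi⟩ := hne k k' hkk σ
    exact hi (hσ i)

/-! ### Transfer between the factors and the ultraproduct -/

section Ultraproduct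

variable {Λ : Type v} {U : Ultrafilter Λ} {H : Λ → Type u} [∀ i, CommMonoid (H i)]

theorem ultraCon_mk_eq_iff {a b : ∀ i, H i} :
    (ultraCon U H).mk' a = (ultraCon U H).mk' b ↔ ∀ᶠ i in U, a i = b i :=
  Con.eq _

theorem isUnit_ultraCon_mk_iff {a : ∀ i, H i} :
    IsUnit ((ultraCon U H).mk' a) ↔ ∀ᶠ i in U, IsUnit (a i) := by
  constructor
  · intro h
    obtain ⟨b, hb⟩ := h.exists_right_inv
    obtain ⟨b, rfl⟩ := Con.mk'_surjective b
    rw [← map_mul, ← map_one (ultraCon U H).mk', ultraCon_mk_eq_iff] at hb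
    filter_upwards [hb] with i hi using IsUnit.of_mul_eq_one _ hi
  · intro h
    -- Witnesses are chosen index by index, with the default `1` where none exists; such indices lie
    -- outside a member of `U`.
    have : ∀ i, ∃ b, IsUnit (a i) → a i * b = 1 := fun i => by
      by_cases hi : IsUnit (a i)
      · exact hi.exists_right_inv.imp fun _ hb _ => hb
      · exact ⟨1, fun h => absurd h hi⟩
    choose b hb using this
    refine IsUnit.of_mul_eq_one ((ultraCon U H).mk' b) ?_
    rw [← map_mul, ← map_one (ultraCon U H).mk', ultraCon_mk_eq_iff]
    filter_upwards [h] with i hi using hb i hi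

theorem associated_ultraCon_mk_iff {a b : ∀ i, H i} :
    Associated ((ultraCon U H).mk' a) ((ultraCon U H).mk' b) ↔
      ∀ᶠ i in U, Associated (a i) (b i) := by
  constructor
  · rintro ⟨c, hc⟩
    obtain ⟨d, hd⟩ := Con.mk'_surjective (c : (ultraCon U H).Quotient)
    have hu := isUnit_ultraCon_mk_iff.1 (hd ▸ c.isUnit)
    rw [← hd, ← map_mul, ultraCon_mk_eq_iff] at hc
    filter_upwards [hu, hc] with i hi hi' using ⟨hi.unit, hi'⟩
  · intro h
    have : ∀ i, ∃ c : (H i)ˣ, Associated (a i) (b i) → a i * c = b i := fun i => by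
      by_cases hi : Associated (a i) (b i)
      · exact hi.imp fun _ hb _ => hb
      · exact ⟨1, fun h => absurd h hi⟩
    choose c hc using this
    have hu : IsUnit ((ultraCon U H).mk' fun i => (c i : H i)) :=
      isUnit_ultraCon_mk_iff.2 (Eventually.of_forall fun i => (c i).isUnit)
    refine ⟨hu.unit, ?_⟩
    rw [IsUnit.unit_spec, ← map_mul, ultraCon_mk_eq_iff]
    filter_upwards [h] with i hi using hc i hi

theorem irreducible_ultraCon_mk_iff {a : ∀ i, H i} :
    Irreducible ((ultraCon U H).mk' a) ↔ ∀ᶠ i in U, Irreducible (a i) := by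
  constructor
  · intro h
    have hu := h.not_isUnit
    rw [isUnit_ultraCon_mk_iff, ← Ultrafilter.eventually_not] at hu
    -- At each index take a factorization into two non-units if there is one, and `1 * a i`
    -- otherwise. If one of the two factors is a unit although `a i` is not, then `a i` is
    -- irreducible.
    have : ∀ i, ∃ b c : H i, a i = b * c ∧
        (¬ IsUnit (a i) → IsUnit b ∨ IsUnit c → Irreducible (a i)) := fun i => by
      by_cases hi : ∃ b c : H i, a i = b * c ∧ ¬ (IsUnit b ∨ IsUnit c)
      · obtain ⟨b, c, hbc, hn⟩ := hi
        exact ⟨b, c, hbc, fun _ h => absurd h hn⟩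
      · push Not at hi
        exact ⟨1, a i, (one_mul _).symm, fun hn _ => ⟨hn, fun {b c} hbc => hi b c hbc⟩⟩
    choose b c hbc hirr using this
    have hor := h.isUnit_or_isUnit (a := (ultraCon U H).mk' b) (b := (ultraCon U H).mk' c) <| by
      rw [← map_mul]; exact congrArg _ (funext hbc)
    rw [isUnit_ultraCon_mk_iff, isUnit_ultraCon_mk_iff, ← Ultrafilter.eventually_or] at hor
    filter_upwards [hu, hor] with i hi hi' using hirr i hi hi'
  · intro h
    refine ⟨fun hu => ?_, fun b c hbc => ?_⟩
    · obtain ⟨i, hi, hi'⟩ := (h.and (isUnit_ultraCon_mk_iff.1 hu)).exists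
      exact hi.not_isUnit hi'
    · obtain ⟨b, rfl⟩ := Con.mk'_surjective b
      obtain ⟨c, rfl⟩ := Con.mk'_surjective c
      rw [← map_mul, ultraCon_mk_eq_iff] at hbc
      rw [isUnit_ultraCon_mk_iff, isUnit_ultraCon_mk_iff, ← Ultrafilter.eventually_or]
      filter_upwards [h, hbc] with i hi hi' using hi.isUnit_or_isUnit hi'

/-- All inner quantifiers range over finite types, and an ultrafilter commutes with finite
conjunctions, finite disjunctions and negation. Only the outer choice of atoms needs representatives
in one direction and indexwise witnesses in the other. -/
theorem natCast_le_lengthMultiplicity_ultraCon_mk_iff {a : ∀ i, H i} {n ℓ : ℕ} :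
    (n : Cardinal) ≤ lengthMultiplicity ((ultraCon U H).mk' a) ℓ ↔
      ∀ᶠ i in U, (n : Cardinal) ≤ lengthMultiplicity (a i) ℓ := by
  simp only [natCast_le_lengthMultiplicity_iff]
  have key : ∀ F : Fin n → Fin ℓ → ∀ i, H i,
      ((∀ k j, Irreducible ((ultraCon U H).mk' (F k j))) ∧
        (∀ k, ∏ j, (ultraCon U H).mk' (F k j) = (ultraCon U H).mk' a) ∧
        ∀ k k', k ≠ k' → ∀ σ : Equiv.Perm (Fin ℓ),
          ∃ j, ¬ Associated ((ultraCon U H).mk' (F k j)) ((ultraCon U H).mk' (F k' (σ j)))) ↔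
      ∀ᶠ i in U, (∀ k j, Irreducible (F k j i)) ∧ (∀ k, ∏ j, F k j i = a i) ∧
        ∀ k k', k ≠ k' → ∀ σ : Equiv.Perm (Fin ℓ),
          ∃ j, ¬ Associated (F k j i) (F k' (σ j) i) := by
    intro F
    simp only [← map_prod, ultraCon_mk_eq_iff, irreducible_ultraCon_mk_iff,
      associated_ultraCon_mk_iff, eventually_and, eventually_all, Finset.prod_apply,
      ← Ultrafilter.eventually_not, Ultrafilter.eventually_exists_iff]
  constructor
  · rintro ⟨f, hf⟩
    choose F hF using fun k j => Con.mk'_surjective (c := ultraCon U H) (f k j)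
    simp only [← hF] at hf
    filter_upwards [(key F).1 hf] with i hi using ⟨fun k j => F k j i, hi⟩
  · intro h
    have : ∀ i, ∃ f : Fin n → Fin ℓ → H i, (∃ f : Fin n → Fin ℓ → H i,
        (∀ k j, Irreducible (f k j)) ∧ (∀ k, ∏ j, f k j = a i) ∧
        ∀ k k', k ≠ k' → ∀ σ : Equiv.Perm (Fin ℓ), ∃ j, ¬ Associated (f k j) (f k' (σ j))) →
        (∀ k j, Irreducible (f k j)) ∧ (∀ k, ∏ j, f k j = a i) ∧
        ∀ k k', k ≠ k' → ∀ σ : Equiv.Perm (Fin ℓ), ∃ j, ¬ Associated (f k j) (f k' (σ j)) :=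
      fun i => by
        by_cases hi : ∃ f : Fin n → Fin ℓ → H i,
          (∀ k j, Irreducible (f k j)) ∧ (∀ k, ∏ j, f k j = a i) ∧
          ∀ k k', k ≠ k' → ∀ σ : Equiv.Perm (Fin ℓ), ∃ j, ¬ Associated (f k j) (f k' (σ j))
        · exact hi.imp fun _ h _ => h
        · exact ⟨fun _ _ => 1, fun h => absurd h hi⟩
    choose f hf using this
    refine ⟨fun k j => (ultraCon U H).mk' fun i => f i k j, (key fun k j i => f i k j).2 ?_⟩
    filter_upwards [h] with i hi using hf i hi

end Ultraproduct

/-! ### Cancellation, torsion-freeness and unique products -/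

instance Ultraproduct.isCancelMul {Λ : Type v} (U : Ultrafilter Λ) (H : Λ → Type u)
    [∀ i, CancelCommMonoid (H i)] : IsCancelMul (Ultraproduct U H) :=
  have : IsLeftCancelMul (Ultraproduct U H) := ⟨fun a b c hbc => by
    obtain ⟨a, rfl⟩ := Con.mk'_surjective a
    obtain ⟨b, rfl⟩ := Con.mk'_surjective b
    obtain ⟨c, rfl⟩ := Con.mk'_surjective c
    change _ * _ = _ * _ at hbc
    rw [← map_mul, ← map_mul, ultraCon_mk_eq_iff] at hbc
    rw [ultraCon_mk_eq_iff]
    filter_upwards [hbc] with i hi using mul_left_cancel hi⟩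
  CommMagma.IsLeftCancelMul.toIsCancelMul _

theorem isMulTorsionFree_ultraproduct {Λ : Type v} (U : Ultrafilter Λ) (H : Λ → Type u)
    [∀ i, CommMonoid (H i)] [∀ i, IsMulTorsionFree (H i)] :
    IsMulTorsionFree (Ultraproduct U H) where
  pow_left_injective n hn a b hab := by
    obtain ⟨a, rfl⟩ := Con.mk'_surjective a
    obtain ⟨b, rfl⟩ := Con.mk'_surjective b
    change _ ^ _ = _ ^ _ at hab
    rw [← map_pow, ← map_pow, ultraCon_mk_eq_iff] at hab
    rw [ultraCon_mk_eq_iff]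
    filter_upwards [hab] with i hi using pow_left_injective hn hi

/-- The property concerns two finite sets at a time, so it can be checked in the submonoid they
generate, which is finitely generated, cancellative and torsion-free. -/
theorem twoUniqueProds_of_isMulTorsionFree (G : Type u) [CommMonoid G] [IsCancelMul G]
    [IsMulTorsionFree G] : TwoUniqueProds G where
  uniqueMul_of_one_lt_card {A B} hAB := by
    classical
    let S : Submonoid G := Submonoid.closure (A ∪ B : Finset G)
    let _ : CancelCommMonoid S :=
      { (inferInstance : CommMonoid S) with
        mul_left_cancel := fun a b c h => Subtype.ext (mul_left_cancel (congrArg Subtype.val h)) }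
    have : Monoid.FG S := (Monoid.fg_iff_submonoid_fg S).2 ⟨A ∪ B, rfl⟩
    have hA : ∀ a ∈ A, a ∈ S := fun a ha => Submonoid.subset_closure (by simp [ha])
    have hB : ∀ b ∈ B, b ∈ S := fun b hb => Submonoid.subset_closure (by simp [hb])
    have : IsMulTorsionFree S := ⟨fun n hn a b h =>
      Subtype.ext (pow_left_injective hn (congrArg Subtype.val h))⟩
    have h2 : TwoUniqueProds S := inferInstance
    have cA : (A.subtype (· ∈ S)).card = A.card := by
      rw [Finset.card_subtype, Finset.filter_true_of_mem hA]
    have cB : (B.subtype (· ∈ S)).card = B.card := by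
      rw [Finset.card_subtype, Finset.filter_true_of_mem hB]
    obtain ⟨p, hp, q, hq, hpq, up, uq⟩ := h2.uniqueMul_of_one_lt_card
      (A := A.subtype (· ∈ S)) (B := B.subtype (· ∈ S)) (by rwa [cA, cB])
    have tr : ∀ {p : S × S}, UniqueMul (A.subtype (· ∈ S)) (B.subtype (· ∈ S)) p.1 p.2 →
        UniqueMul A B (p.1 : G) p.2 := fun {p} h a b ha hb hab => by
      have := @h ⟨a, hA a ha⟩ ⟨b, hB b hb⟩ (by simpa using ha) (by simpa using hb)
        (Subtype.ext hab)
      exact ⟨congrArg Subtype.val this.1, congrArg Subtype.val this.2⟩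
    rw [Finset.mem_product, Finset.mem_subtype, Finset.mem_subtype] at hp hq
    refine ⟨(p.1, p.2), Finset.mem_product.2 hp, (q.1, q.2), Finset.mem_product.2 hq,
      fun h => hpq ?_, tr up, tr uq⟩
    rw [Prod.mk.injEq] at h
    exact Prod.ext (Subtype.ext h.1) (Subtype.ext h.2)

/-! ### Factorizations of monomials in the semigroup ring -/

namespace MonoidAlgebra

variable {K : Type w} {G : Type u} [Field K] [CommMonoid G] [TwoUniqueProds G]

theorem exists_eq_single_of_mul_eq_single {f g : MonoidAlgebra K G} {a : G} {r : K} (hr : r ≠ 0)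
    (h : f * g = single a r) :
    ∃ b c x y, b * c = a ∧ x * y = r ∧ f = single b x ∧ g = single c y := by
  have hfg : f * g ≠ 0 := by rw [h]; simpa using hr
  have hf : f.coeff.support.Nonempty :=
    Finsupp.support_nonempty_iff.2 fun h0 => hfg (by rw [coeff_eq_zero.1 h0, zero_mul])
  have hg : g.coeff.support.Nonempty :=
    Finsupp.support_nonempty_iff.2 fun h0 => hfg (by rw [coeff_eq_zero.1 h0, mul_zero])
  -- Otherwise two different pairs of support elements give unique products. Each yields a nonzero
  -- coefficient of `f * g`, so both products equal `a`, against uniqueness.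
  have hcard : ¬ 1 < f.coeff.support.card * g.coeff.support.card := by
    intro hlt
    obtain ⟨p, hp, q, hq, hpq, up, uq⟩ := TwoUniqueProds.uniqueMul_of_one_lt_card hlt
    rw [Finset.mem_product] at hp hq
    have key : ∀ {p : G × G}, p.1 ∈ f.coeff.support → p.2 ∈ g.coeff.support →
        UniqueMul f.coeff.support g.coeff.support p.1 p.2 → p.1 * p.2 = a := by
      intro p h1 h2 hu
      by_contra hne
      have := coeff_mul_mul_of_uniqueMul hu
      rw [h, coeff_single, Finsupp.single_eq_of_ne hne] at this
      exact mul_ne_zero (Finsupp.mem_support_iff.1 h1) (Finsupp.mem_support_iff.1 h2) this.symm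
    have := uq hp.1 hp.2 ((key hp.1 hp.2 up).trans (key hq.1 hq.2 uq).symm)
    exact hpq (Prod.ext this.1 this.2)
  have h1 := Finset.card_pos.2 hf
  have h2 := Finset.card_pos.2 hg
  have hf1 : f.coeff.support.card = 1 := by nlinarith
  have hg1 : g.coeff.support.card = 1 := by nlinarith
  obtain ⟨b, x, hx, hb⟩ := Finsupp.card_support_eq_one'.1 hf1
  obtain ⟨c, y, hy, hc⟩ := Finsupp.card_support_eq_one'.1 hg1
  obtain rfl : f = single b x := coeff_injective hb
  obtain rfl : g = single c y := coeff_injective hc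
  rw [single_mul_single] at h
  have := single_inj.1 h
  refine ⟨b, c, x, y, ?_, ?_, rfl, rfl⟩
  · simp_all
  · simp_all

variable (K G) in
/-- The monomials with coefficient `1`, in the monoid of regular elements. -/
noncomputable def monomialHom : G →* nonZeroDivisors (MonoidAlgebra K G) where
  toFun a := ⟨single a 1, mem_nonZeroDivisors_of_ne_zero (by simp)⟩
  map_one' := rfl
  map_mul' a b := Subtype.ext (by simp)

theorem coe_monomialHom (a : G) : (monomialHom K G a : MonoidAlgebra K G) = single a 1 := rfl

/-- Nonzero scalars are units, so coefficients of monomials are irrelevant up to associates. -/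
theorem associated_monomialHom_of_eq_single {f : nonZeroDivisors (MonoidAlgebra K G)} {b : G}
    {x : K} (hx : x ≠ 0) (hf : (f : MonoidAlgebra K G) = single b x) :
    Associated (monomialHom K G b) f := by
  have hu : ∀ z : K, z ≠ 0 → (single 1 z : MonoidAlgebra K G) ∈
    nonZeroDivisors (MonoidAlgebra K G) := fun z hz =>
      mem_nonZeroDivisors_of_ne_zero (by simpa using hz)
  refine ⟨⟨⟨_, hu x hx⟩, ⟨_, hu x⁻¹ (inv_ne_zero hx)⟩, Subtype.ext ?_, Subtype.ext ?_⟩,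
    Subtype.ext ?_⟩
  · simp [single_mul_single, hx, one_def]
  · simp [single_mul_single, hx, one_def]
  · simp [hf, coe_monomialHom, single_mul_single]

theorem isUnit_monomialHom_iff {a : G} : IsUnit (monomialHom K G a) ↔ IsUnit a := by
  refine ⟨fun h => ?_, fun h => h.map _⟩
  obtain ⟨g, hg⟩ := h.exists_right_inv
  obtain ⟨b, c, x, y, hbc, -, hb, -⟩ :=
    exists_eq_single_of_mul_eq_single (one_ne_zero (α := K)) (congrArg Subtype.val hg)
  obtain ⟨rfl, -⟩ : a = b ∧ (1 : K) = x := by simpa [coe_monomialHom, single_inj] using hb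
  exact IsUnit.of_mul_eq_one _ hbc

theorem associated_monomialHom_iff {a b : G} :
    Associated (monomialHom K G a) (monomialHom K G b) ↔ Associated a b := by
  refine ⟨?_, fun ⟨v, hv⟩ => ⟨Units.map (monomialHom K G) v, ?_⟩⟩
  · rintro ⟨g, hg⟩
    obtain ⟨c, d, x, y, hcd, hxy, hc, hd⟩ :=
      exists_eq_single_of_mul_eq_single (one_ne_zero (α := K)) (congrArg Subtype.val hg)
    obtain ⟨rfl, rfl⟩ : a = c ∧ (1 : K) = x := by simpa [coe_monomialHom, single_inj] using hc
    have : monomialHom K G d = g := Subtype.ext (by rw [hd, coe_monomialHom]; simp_all)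
    exact ⟨(isUnit_monomialHom_iff.1 (this ▸ g.isUnit)).unit, hcd⟩
  · rw [← hv, map_mul]; rfl

theorem irreducible_monomialHom_iff {a : G} :
    Irreducible (monomialHom K G a) ↔ Irreducible a := by
  constructor
  · intro h
    refine ⟨fun hu => h.not_isUnit (hu.map _), fun b c hbc => ?_⟩
    rw [← isUnit_monomialHom_iff (K := K) (a := b), ← isUnit_monomialHom_iff (K := K) (a := c)]
    exact h.isUnit_or_isUnit (by rw [hbc, map_mul])
  · intro h
    refine ⟨fun hu => h.not_isUnit (isUnit_monomialHom_iff.1 hu), fun f g hfg => ?_⟩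
    obtain ⟨b, c, x, y, hbc, hxy, hf, hg⟩ :=
      exists_eq_single_of_mul_eq_single (one_ne_zero (α := K)) (congrArg Subtype.val hfg).symm
    have hf := associated_monomialHom_of_eq_single (left_ne_zero_of_mul_eq_one hxy) hf
    have hg := associated_monomialHom_of_eq_single (right_ne_zero_of_mul_eq_one hxy) hg
    rw [← hf.isUnit_iff, ← hg.isUnit_iff, isUnit_monomialHom_iff, isUnit_monomialHom_iff]
    exact h.isUnit_or_isUnit hbc.symm

theorem exists_eq_single_of_prod_eq_single {ℓ : ℕ} {f : Fin ℓ → MonoidAlgebra K G}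
    {a : G} {r : K} (hr : r ≠ 0) (h : ∏ i, f i = single a r) :
    ∃ (b : Fin ℓ → G) (x : Fin ℓ → K), ∏ i, b i = a ∧ ∀ i, x i ≠ 0 ∧ f i = single (b i) (x i) := by
  induction ℓ generalizing a r with
  | zero =>
    refine ⟨Fin.elim0, Fin.elim0, ?_, fun i => i.elim0⟩
    have : (1 : G) = a ∧ (1 : K) = r := by simpa [one_def, single_inj, hr] using h
    simp [this.1]
  | succ n ih =>
    rw [Fin.prod_univ_succ] at h
    obtain ⟨b, c, x, y, rfl, rfl, hb, hc⟩ := exists_eq_single_of_mul_eq_single hr h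
    obtain ⟨d, z, rfl, hdz⟩ := ih (right_ne_zero_of_mul hr) hc
    exact ⟨Fin.cons b d, Fin.cons x z, by simp [Fin.prod_univ_succ],
      Fin.cases ⟨left_ne_zero_of_mul hr, hb⟩ hdz⟩

/-- The two classes of factorizations are in bijection but live in different universes; `toENat`
compares them and keeps all that is needed, as infinite multiplicities are not distinguished. -/
theorem toENat_lengthMultiplicity_monomialHom (a : G) (ℓ : ℕ) :
    toENat (lengthMultiplicity (monomialHom K G a) ℓ) = toENat (lengthMultiplicity a ℓ) := by
  let F : Factorization a ℓ → Factorization (monomialHom K G a) ℓ := fun α =>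
    ⟨fun i => monomialHom K G (α.1 i), fun i => irreducible_monomialHom_iff.2 (α.2.1 i), by
      rw [← map_prod, α.2.2]⟩
  have hF : ∀ α β, (essentiallySame a ℓ).r α β ↔ (essentiallySame _ ℓ).r (F α) (F β) :=
    fun α β => by
      change (∃ _, _) ↔ ∃ _, _
      simp only [F, associated_monomialHom_iff]
  symm
  refine toENat_congr (Equiv.ofBijective (Quotient.map F fun α β => (hF α β).1) ⟨?_, ?_⟩)
  · rintro ⟨α⟩ ⟨β⟩ h
    exact Quotient.sound ((hF α β).2 (Quotient.exact h))
  · rintro ⟨β⟩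
    obtain ⟨b, x, hb, hb'⟩ := exists_eq_single_of_prod_eq_single
      (f := fun i => (β.1 i : MonoidAlgebra K G)) (one_ne_zero (α := K))
      (by simpa [coe_monomialHom] using congrArg Subtype.val β.2.2)
    replace hb' := fun i => associated_monomialHom_of_eq_single (hb' i).1 (hb' i).2
    refine ⟨⟦⟨b, fun i => irreducible_monomialHom_iff.1 ((hb' i).irreducible_iff.2 (β.2.1 i)), hb⟩⟧,
      Quotient.sound ⟨1, hb'⟩⟩

end MonoidAlgebra

/-! ### The monoid of blocks -/

section BlockMonoid

variable {P : Type} {S : Type u} (π : S → P) (len : S → ℕ)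

/-- The value of a formal product of generators `⟨s, i⟩`, in the group with these generators in
which, for each `s`, the product over all `i` depends only on `π s`. The second component
exhibits `⟨s, 0⟩` as the quotient of that product by the other generators `⟨s, i⟩`. -/
noncomputable def blockValue :
    Multiset (Σ s, Fin (len s + 2)) →+ (P → ℤ) × ((Σ s, Fin (len s + 2)) → ℤ) :=
  open Classical in
  { toFun := fun c => (fun p => (c.countP fun a => a.2 = 0 ∧ π a.1 = p : ℤ),
      fun a => c.count a - c.count ⟨a.1, 0⟩)
    map_zero' := by ext <;> simp
    map_add' := fun c d => by
      ext
      · simp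
      · simp only [Multiset.count_add, Nat.cast_add, Prod.snd_add, Pi.add_apply]; ring }

variable {π len}

open Classical in
theorem blockValue_eq_iff {c d : Multiset (Σ s, Fin (len s + 2))} :
    blockValue π len c = blockValue π len d ↔
      (∀ p, (c.countP fun a => a.2 = 0 ∧ π a.1 = p) = d.countP fun a => a.2 = 0 ∧ π a.1 = p) ∧
      ∀ a, c.count a + d.count ⟨a.1, 0⟩ = d.count a + c.count ⟨a.1, 0⟩ := by
  simp only [blockValue, AddMonoidHom.coe_mk, ZeroHom.coe_mk, Prod.ext_iff, funext_iff,
    Nat.cast_inj]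
  refine and_congr_right fun _ => forall_congr' fun a => ?_
  omega

open Classical in
theorem count_zero_eq_zero {c : Multiset (Σ s, Fin (len s + 2))}
    (h : ∀ p, (c.countP fun a => a.2 = 0 ∧ π a.1 = p) = 0) (s : S) : c.count ⟨s, 0⟩ = 0 :=
  Multiset.count_eq_zero.2 fun hs => Multiset.countP_eq_zero.1 (h (π s)) _ hs ⟨rfl, rfl⟩

open Classical in
-- The first component of the value counts the generators with index `0` by their class under `π`;
-- here it leaves room for only one of them.
theorem exists_count_zero_eq {c : Multiset (Σ s, Fin (len s + 2))} {p : P}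
    (h : ∀ q, (c.countP fun a => a.2 = 0 ∧ π a.1 = q) = if q = p then 1 else 0) :
    ∃ s, π s = p ∧ ∀ t, c.count ⟨t, 0⟩ = if t = s then 1 else 0 := by
  have hp := h p
  rw [if_pos rfl, Multiset.countP_eq_card_filter, Multiset.card_eq_one] at hp
  obtain ⟨⟨s, i⟩, hs⟩ := hp
  have hmem : (⟨s, i⟩ : Σ s, Fin (len s + 2)) ∈ c.filter fun a => a.2 = 0 ∧ π a.1 = p := by
    rw [hs]; exact Multiset.mem_singleton_self _
  obtain ⟨-, hi, hsp⟩ := Multiset.mem_filter.1 hmem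
  obtain rfl : i = 0 := hi
  refine ⟨s, hsp, fun t => ?_⟩
  by_cases ht : π t = p
  · have := Multiset.count_filter_of_pos (s := c)
      (p := fun a : Σ s, Fin (len s + 2) => a.2 = 0 ∧ π a.1 = p) (a := ⟨t, 0⟩) ⟨rfl, ht⟩
    rw [← this, hs, Multiset.count_singleton]
    refine if_congr ⟨fun h => congrArg Sigma.fst h, fun h => by rw [h]⟩ rfl rfl
  · rw [if_neg (fun hts : t = s => ht (by rw [hts, hsp]))]
    have := h (π t)
    rw [if_neg ht] at this
    exact Multiset.count_eq_zero.2 fun hs => Multiset.countP_eq_zero.1 this _ hs ⟨rfl, rfl⟩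

theorem eq_zero_of_blockValue_eq_zero {c : Multiset (Σ s, Fin (len s + 2))}
    (h : blockValue π len c = 0) : c = 0 := by
  classical
  rw [← map_zero (blockValue π len), blockValue_eq_iff] at h
  have h0 := count_zero_eq_zero (π := π) (c := c) (by simpa using h.1)
  exact Multiset.ext.2 fun a => by simpa [h0] using h.2 a

theorem eq_singleton_of_blockValue_eq {c : Multiset (Σ s, Fin (len s + 2))}
    {a : Σ s, Fin (len s + 2)} (h : blockValue π len c = blockValue π len {a}) : c = {a} := by
  classical
  obtain ⟨s, i⟩ := a
  rw [blockValue_eq_iff] at h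
  have hP : ∀ p, Multiset.countP (fun a : Σ s, Fin (len s + 2) => a.2 = 0 ∧ π a.1 = p) {⟨s, i⟩} =
      if i = 0 ∧ π s = p then 1 else 0 := fun p => by
    rw [← Multiset.cons_zero, Multiset.countP_cons, Multiset.countP_zero, zero_add]
  have hroot : ∀ t, c.count ⟨t, 0⟩ =
      ({⟨s, i⟩} : Multiset (Σ s, Fin (len s + 2))).count ⟨t, 0⟩ := by
    by_cases hi : i = 0
    · subst hi
      obtain ⟨s', -, ht⟩ := exists_count_zero_eq (π := π) (c := c) (p := π s) fun q => by
        rw [h.1, hP]; simp [eq_comm]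
      -- Every block has at least two generators. If `s ≠ s'`, the second component at `⟨s, 1⟩`
      -- would be `-1` for `{⟨s, 0⟩}` but nonnegative for `c`.
      have h1 := h.2 ⟨s, 1⟩
      have hs : s = s' := by
        by_contra hs
        rw [ht, if_neg hs] at h1
        simp at h1
      subst hs
      intro t
      rw [ht, Multiset.count_singleton]
      exact if_congr ⟨fun h => by rw [h], fun h => congrArg Sigma.fst h⟩ rfl rfl
    · have h0 := count_zero_eq_zero (π := π) (c := c) fun p => by rw [h.1, hP]; simp [hi]
      intro t
      rw [h0, eq_comm, Multiset.count_eq_zero, Multiset.mem_singleton]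
      rintro h
      obtain rfl : t = s := congrArg Sigma.fst h
      exact hi (by simpa using h.symm)
  exact Multiset.ext.2 fun a => by have := h.2 a; rw [hroot] at this; omega

/-- The formal product of all generators `⟨s, i⟩` with the given `s`. -/
def block (len : S → ℕ) (s : S) : Multiset (Σ s, Fin (len s + 2)) :=
  Finset.univ.val.map (Sigma.mk s)

open Classical in
theorem count_block (s : S) (a : Σ s, Fin (len s + 2)) :
    (block len s).count a = if a.1 = s then 1 else 0 := by
  rw [block, Multiset.count_eq_of_nodup
    (Multiset.Nodup.map sigma_mk_injective Finset.univ.nodup)]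
  refine if_congr ⟨fun h => ?_, fun h => ?_⟩ rfl rfl
  · obtain ⟨i, -, rfl⟩ := Multiset.mem_map.1 h
    rfl
  · obtain ⟨t, i⟩ := a
    obtain rfl : t = s := h
    exact Multiset.mem_map.2 ⟨i, Finset.mem_univ_val i, rfl⟩

theorem card_block (s : S) : (block len s).card = len s + 2 := by simp [block]

theorem block_injective : Function.Injective (block len) := fun s t h => by
  classical
  have := congrArg (Multiset.count ⟨s, 0⟩) h
  rw [count_block, count_block] at this
  by_contra hst
  simp [hst] at this

theorem countP_block [DecidableEq P] (s : S) (p : P)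
    [DecidablePred fun a : Σ s, Fin (len s + 2) => a.2 = 0 ∧ π a.1 = p] :
    ((block len s).countP fun a => a.2 = 0 ∧ π a.1 = p) = if p = π s then 1 else 0 := by
  classical
  rw [block, Multiset.countP_map]
  by_cases h : p = π s
  · subst h
    simp only [and_true, if_pos]
    rw [← Finset.filter_val, Finset.card_val, Finset.card_eq_one]
    exact ⟨0, by ext; simp⟩
  · simp [h, Ne.symm h]

/-- The second component of a block vanishes, so in `c` every generator occurs as often as the
index-`0` generator of its block. Only one of these occurs, once, and its block has the class of
`s`. -/
theorem blockValue_eq_block_iff {c : Multiset (Σ s, Fin (len s + 2))} {s : S} :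
    blockValue π len c = blockValue π len (block len s) ↔ ∃ t, π t = π s ∧ c = block len t := by
  classical
  rw [blockValue_eq_iff]
  constructor
  · rintro ⟨h1, h2⟩
    simp only [countP_block] at h1
    obtain ⟨t, ht, hc⟩ := exists_count_zero_eq h1
    refine ⟨t, ht, Multiset.ext.2 fun a => ?_⟩
    have := h2 a
    simp only [count_block, hc] at this ⊢
    omega
  · rintro ⟨t, ht, rfl⟩
    simp only [countP_block, count_block, ht, implies_true, true_and]
    intro a
    omega

/-- The multiplicative monoid of values of formal products of generators. -/
abbrev BlockMonoid (π : S → P) (len : S → ℕ) : Type u :=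
  Multiplicative (AddMonoidHom.mrange (blockValue π len))

noncomputable instance : CancelCommMonoid (BlockMonoid π len) where
  toCommMonoid := inferInstance
  mul_left_cancel _ _ _ h :=
    Subtype.ext (add_left_cancel (congrArg (fun c => (Multiplicative.toAdd c).1) h))

instance : IsMulTorsionFree (BlockMonoid π len) where
  pow_left_injective _ hn _ _ h :=
    Subtype.ext (nsmul_right_injective hn (congrArg (fun c => (Multiplicative.toAdd c).1) h))

theorem lengthMultiplicity_block (s : S) (ℓ : ℕ) :
    lengthMultiplicity (M := BlockMonoid π len)
      (Multiplicative.ofAdd ((blockValue π len).mrangeRestrict (block len s))) ℓ =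
    Cardinal.mk {t : S // π t = π s ∧ len t + 2 = ℓ} := by
  have hprod : ∀ c : Multiset (Σ s, Fin (len s + 2)),
      (c.map fun a => (Multiplicative.ofAdd ((blockValue π len).mrangeRestrict {a}) :
        BlockMonoid π len)).prod =
      Multiplicative.ofAdd ((blockValue π len).mrangeRestrict c) := by
    intro c
    induction c using Multiset.induction_on with
    | empty => simp
    | cons a c ih =>
      rw [Multiset.map_cons, Multiset.prod_cons, ih, ← ofAdd_add, ← map_add,
        Multiset.singleton_add]
  have hinj : ∀ {c d : Multiset (Σ s, Fin (len s + 2))},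
      (Multiplicative.ofAdd ((blockValue π len).mrangeRestrict c) : BlockMonoid π len) =
        Multiplicative.ofAdd ((blockValue π len).mrangeRestrict d) ↔
      blockValue π len c = blockValue π len d := Subtype.ext_iff
  rw [lengthMultiplicity_of_generators (M := BlockMonoid π len)
    (fun a => Multiplicative.ofAdd ((blockValue π len).mrangeRestrict {a}))]
  · simp only [hprod, hinj, blockValue_eq_block_iff]
    symm
    refine Cardinal.mk_congr (Equiv.ofBijective
      (fun t => ⟨block len t.1, (card_block _).trans t.2.2, t.1, t.2.1, rfl⟩) ⟨?_, ?_⟩)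
    · intro t t' h
      exact Subtype.ext (block_injective (congrArg Subtype.val h))
    · rintro ⟨_, h, t, ht, rfl⟩
      exact ⟨⟨t, ht, (card_block _).symm.trans h⟩, rfl⟩
  · rintro ⟨_, c, rfl⟩
    exact ⟨c, hprod c⟩
  · intro c hc
    rw [hprod] at hc
    exact eq_zero_of_blockValue_eq_zero (congrArg (fun c => (Multiplicative.toAdd c).1) hc)
  · intro c a hc
    rw [hprod, hinj] at hc
    exact eq_singleton_of_blockValue_eq hc

end BlockMonoid

/-! ### Realization of multisets and the main theorem -/

/-- A torsion-free cancellative monoid in which all finite multisets are realized. -/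
theorem exists_realizesFiniteMultisets : ∃ (M : Type u) (_ : CancelCommMonoid M),
    RealizesFiniteMultisets M ∧ IsMulTorsionFree M := by
  -- A triple `(L, m, k)` indexes the `k`-th copy of the length `m` in `L`. Its block has `(m - 2) +
  -- 2 = m` generators, and `π` remembers only `L`.
  let S : Type u :=
    ULift {t : Multiset ℕ × ℕ × ℕ // 2 ≤ t.2.1 ∧ t.2.2 < t.1.count t.2.1}
  let π : S → Multiset ℕ := fun s => s.down.1.1
  let len : S → ℕ := fun s => s.down.1.2.1 - 2
  refine ⟨BlockMonoid π len, inferInstance, fun L hL h2 => ?_, inferInstance⟩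
  obtain ⟨m, hm⟩ := Multiset.exists_mem_of_ne_zero hL
  let s : S := ⟨⟨(L, m, 0), h2 m hm, Multiset.count_pos.2 hm⟩⟩
  refine ⟨_, fun ℓ => (lengthMultiplicity_block s ℓ).trans ?_⟩
  have : (L.count ℓ : Cardinal.{u}) = Cardinal.mk (ULift.{u} (Fin (L.count ℓ))) := by simp
  rw [this]
  symm
  have hpos : ∀ k : Fin (L.count ℓ), 2 ≤ ℓ := fun k =>
    h2 ℓ (Multiset.count_pos.1 (k.1.zero_le.trans_lt k.2))
  refine Cardinal.mk_congr (Equiv.ofBijective (fun k => ⟨⟨⟨(L, ℓ, k.down), hpos k.down, k.down.2⟩⟩,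
    rfl, Nat.sub_add_cancel (hpos k.down)⟩) ⟨?_, ?_⟩)
  · intro k k' h
    exact ULift.ext _ _ (Fin.ext (congrArg (fun t => t.1.down.1.2.2) h))
  · rintro ⟨⟨⟨⟨L', m', k⟩, hm', hk⟩⟩, hL', hℓ⟩
    obtain rfl : L' = L := hL'
    obtain rfl : m' = ℓ := (Nat.sub_add_cancel hm').symm.trans hℓ
    exact ⟨⟨⟨k, hk⟩⟩, rfl⟩

/-- An element of the ultraproduct with prescribed multiplicities, up to the distinction of
infinite ones. -/
theorem exists_toENat_lengthMultiplicity_eq {U : Ultrafilter ℕ} (hU : ∀ n : ℕ, ({n} : Set ℕ) ∉ U)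
    (H : ℕ → Type u) [∀ i, CommMonoid (H i)] (hH : ∀ i, RealizesFiniteMultisets (H i))
    (L : ℕ → ℕ∞) (hL : ∀ ℓ < 2, L ℓ = 0) :
    ∃ h : Ultraproduct U H, ∀ ℓ, toENat (lengthMultiplicity h ℓ) = L ℓ := by
  have hle : (U : Filter ℕ) ≤ atTop := by
    rw [← Nat.cofinite_eq_atTop]
    refine U.le_cofinite_or_eq_pure.resolve_right ?_
    rintro ⟨n, rfl⟩
    exact hU n rfl
  -- Truncate `L` to lengths at most `i` and multiplicities at most `i`. The extra length `i + 2`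
  -- makes the multiset nonempty and affects no fixed `ℓ` once `i ≥ ℓ`.
  let A : ℕ → Multiset ℕ := fun i =>
    ∑ m ∈ Finset.range (i + 1), Multiset.replicate (min (L m) i).toNat m + {i + 2}
  have hA : ∀ i, ∀ m ∈ A i, 2 ≤ m := by
    intro i m hm
    rcases Multiset.mem_add.1 hm with hm | hm
    · obtain ⟨k, -, hk⟩ := Multiset.mem_sum.1 hm
      obtain ⟨hk, rfl⟩ := Multiset.mem_replicate.1 hk
      by_contra hlt
      simp [hL m (not_le.1 hlt)] at hk
    · rw [Multiset.mem_singleton.1 hm]; omega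
  choose h hh using fun i => hH i (A i) (by simp [A]) (hA i)
  refine ⟨(ultraCon U H).mk' h, fun ℓ => ENat.eq_of_forall_natCast_le_iff fun n => ?_⟩
  rw [natCast_le_toENat, natCast_le_lengthMultiplicity_ultraCon_mk_iff]
  -- For `i ≥ n` the cap at `i` does not influence the comparison with `n`. The right side is
  -- independent of `i`, so it decides the statement in the ultraproduct.
  have hev : ∀ᶠ i in U, ((n : Cardinal) ≤ lengthMultiplicity (h i) ℓ ↔ n ≤ L ℓ) := by
    filter_upwards [hle (eventually_ge_atTop n), hle (eventually_ge_atTop ℓ)] with i hn hℓ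
    have hcount : (A i).count ℓ = (min (L ℓ) i).toNat := by
      have h1 : ℓ < i + 1 := by omega
      have h2 : ℓ ≠ i + 2 := by omega
      simp [A, Multiset.count_sum', Multiset.count_replicate, h1, h2]
    have hne : min (L ℓ) i ≠ ⊤ := ((min_le_right _ _).trans_lt (ENat.natCast_lt_top i)).ne
    rw [hh, hcount, Nat.cast_le, ← Nat.cast_le (α := ℕ∞), ENat.natCast_toNat hne, le_min_iff,
      Nat.cast_le, and_iff_left hn]
  rw [eventually_congr hev, eventually_const]

theorem mainTheorem12 :
    -- torsion-free ultraproducts as required exist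
    (∀ U : Ultrafilter ℕ, (∀ n : ℕ, ({n} : Set ℕ) ∉ U) →
      ∃ (H : ℕ → Type u) (_ : ∀ i, CancelCommMonoid (H i)),
        (∀ i, RealizesFiniteMultisets (H i)) ∧ IsMulTorsionFree (Ultraproduct U H)) ∧
    -- each of them gives integral domains that realize every multiset
    (∀ U : Ultrafilter ℕ, (∀ n : ℕ, ({n} : Set ℕ) ∉ U) →
      ∀ (H : ℕ → Type u) [∀ i, CancelCommMonoid (H i)],
        (∀ i, RealizesFiniteMultisets (H i)) → IsMulTorsionFree (Ultraproduct U H) →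
        ∀ (K : Type w) [Field K],
          IsDomain (MonoidAlgebra K (Ultraproduct U H)) ∧
          RealizesAllMultisets.{max u w, v}
            (nonZeroDivisors (MonoidAlgebra K (Ultraproduct U H)))) := by
  refine ⟨fun U _ => ?_, fun U hU H _ hH _ K _ => ?_⟩
  · obtain ⟨M, _, hM, _⟩ := exists_realizesFiniteMultisets.{u}
    exact ⟨fun _ => M, fun _ => inferInstance, fun _ => hM,
      isMulTorsionFree_ultraproduct U fun _ => M⟩
  · have := twoUniqueProds_of_isMulTorsionFree (Ultraproduct U H)
    refine ⟨inferInstance, fun L hL => ?_⟩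
    obtain ⟨h, hh⟩ := exists_toENat_lengthMultiplicity_eq hU H hH (fun ℓ => toENat (L ℓ))
      fun ℓ hℓ => by rw [hL ℓ hℓ, map_zero]
    refine ⟨MonoidAlgebra.monomialHom K _ h, fun ℓ => ?_⟩
    have key : toENat (lengthMultiplicity (MonoidAlgebra.monomialHom K _ h) ℓ) = toENat (L ℓ) :=
      (MonoidAlgebra.toENat_lengthMultiplicity_monomialHom h ℓ).trans (hh ℓ)
    refine ⟨fun hfin => ?_, by rw [← toENat_eq_top, key, toENat_eq_top]⟩
    obtain ⟨n, hn⟩ := Cardinal.lt_aleph0.1 hfin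
    rw [hn, toENat_nat, toENat_eq_natCast] at key
    rw [hn, key, lift_natCast, lift_natCast]
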